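/- Let $S=\mathbb{C}[x,y,z]$, let $d\ge 3$, and let $f\in S$ be a homogeneous polynomial of degree $d$ without multiple factors, so that $C: f=0$ is a reduced curve of degree $d$ in $\mathbb{P}^2$. Let $$AR(f)=\{(a,b,c)\in S^3 : a f_x+b f_y+c f_z=0\}$$ be the graded $S$-module of Jacobian syzygies of $f$, where $(a,b,c)$ is homogeneous of degree $k$ if $a,b,c$ are homogeneous polynomials of degree $k$. Suppose that $C$ is an $m$-syzygy curve with exponents $1\le d_1\le d_2\le\cdots\le d_m$, i.e. $AR(f)$ is generated by $m$ homogeneous syzygies $\rho_1,\dots,\rho_m$ with $\deg\rho_j=d_j$, and $m$ is the smallest possible number of homogeneous generators of $AR(f)$. Then $m\ge 2$ and $$m\le d_1+d_2-d+3\le d_1+2\le d+1 .$$ -/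

import Mathlib

namespace PlaneCurve

/-- The polynomial ring `S = ℂ[x, y, z]`. -/
abbrev S : Type := MvPolynomial (Fin 3) ℂ

/-- The module `AR(f)` of Jacobian syzygies of `f`: triples `(a, b, c)` in `S³` with
`a f_x + b f_y + c f_z = 0`. -/
noncomputable def AR (f : S) : Submodule S (Fin 3 → S) where
  carrier := {a | ∑ i, a i * MvPolynomial.pderiv i f = 0}
  zero_mem' := by simp
  add_mem' := by
    intro a b ha hb
    simp only [Set.mem_ofPred_eq, Pi.add_apply, add_mul, Finset.sum_add_distrib] at *
    rw [ha, hb, add_zero]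
  smul_mem' := by
    intro c a ha
    simp only [Set.mem_ofPred_eq, Pi.smul_apply, smul_eq_mul, mul_assoc] at *
    rw [← Finset.mul_sum, ha, mul_zero]

/-- The family `ρ` consists of homogeneous triples, `ρ j` of degree `e j` (all three components
are homogeneous polynomials of that degree), and it generates the `S`-module `AR(f)`. -/
structure HomogeneousGenerators (f : S) {m : ℕ} (ρ : Fin m → Fin 3 → S) (e : Fin m → ℕ) :
    Prop where
  homogeneous : ∀ j i, (ρ j i).IsHomogeneous (e j)
  span_eq : Submodule.span S (Set.range ρ) = AR f

/-- `f = 0` is an `m`-syzygy curve with exponents `e 0 ≤ e 1 ≤ ⋯ ≤ e (m - 1)`: the module `AR(f)`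
is generated by `m` homogeneous syzygies of these degrees, and it is not generated by fewer than
`m` homogeneous syzygies. (Minimality forces every generator to be nonzero, so that its degree is
well defined.) -/
structure IsSyzygyCurve (f : S) (m : ℕ) (e : Fin m → ℕ) : Prop where
  monotone : Monotone e
  generated : ∃ ρ : Fin m → Fin 3 → S, HomogeneousGenerators f ρ e
  minimal : ∀ (n : ℕ) (ρ : Fin n → Fin 3 → S) (e' : Fin n → ℕ),
    HomogeneousGenerators f ρ e' → m ≤ n

end PlaneCurve

/- Let `g` be the gradient of `f` and let `ρ₀` be a generating syzygy of least degree `e₀`; it is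
primitive. For every syzygy `σ` the vector `ρ₀ × σ` is a multiple `w g` of `g`, and `σ ↦ w`
identifies the syzygies modulo `ρ₀` with an ideal `I`, shifting degrees by `e₀ - (d - 1)`. The
ideal `I` is saturated, so a general linear form is regular modulo `I`, and the restriction of `I`
to a general line, in a suitable affine chart, is an ideal of `K[u][v]` containing a polynomial
monic in `v` of degree `s = e₀ + e₁ - (d - 1)`, the image of `ρ₁`. Over the principal ideal domain
`K[u]` such an ideal is generated by `s + 1` elements, and a rank argument in the style of
Nakayama's lemma bounds the number of generators of the syzygies by `s + 2`. Finally, the Koszul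
syzygies `b × g` have degree `d - 1` and are not all multiples of a single vector, which gives
`m ≥ 2` and `e₁ ≤ d - 1`. -/

open MvPolynomial Matrix

section PrimitiveVector

variable {R ι : Type*} [CommRing R]

/-- A vector is primitive if its coordinates have no common divisor other than units. -/
def IsPrimitiveVector (a : ι → R) : Prop :=
  ∀ g, (∀ i, g ∣ a i) → IsUnit g

theorem IsPrimitiveVector.ne_zero [Nontrivial R] {a : ι → R} (ha : IsPrimitiveVector a) :
    a ≠ 0 := by
  rintro rfl
  exact not_isUnit_zero (ha 0 fun _ => dvd_rfl)

theorem IsPrimitiveVector.exists_eq_smul [IsDomain R] [UniqueFactorizationMonoid R] [Finite ι]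
    {a b : ι → R} (hb : IsPrimitiveVector b) (h : ∀ i j, a i * b j = a j * b i) :
    ∃ c : R, a = c • b := by
  have := Fintype.ofFinite ι
  let _ : StrongNormalizationMonoid R := UniqueFactorizationMonoid.strongNormalizationMonoid
  let _ : NormalizedGCDMonoid R := UniqueFactorizationMonoid.toNormalizedGCDMonoid R
  obtain ⟨k, hk⟩ := Function.ne_iff.1 hb.ne_zero
  have hgcd : IsUnit (Finset.univ.gcd b) := hb _ fun i => Finset.gcd_dvd (Finset.mem_univ i)
  have hdvd : b k ∣ a k * Finset.univ.gcd b := by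
    have : b k ∣ Finset.univ.gcd fun i => a k * b i :=
      Finset.dvd_gcd fun i _ => ⟨a i, by rw [← h i k, mul_comm]⟩
    exact this.trans (Finset.gcd_mul_left' _ _ _).dvd
  obtain ⟨c, hc⟩ := hgcd.dvd_mul_right.1 hdvd
  refine ⟨c, funext fun i => mul_right_cancel₀ hk ?_⟩
  rw [h i k, hc, Pi.smul_apply, smul_eq_mul]
  ring

theorem IsPrimitiveVector.ker_crossProduct [IsDomain R] [UniqueFactorizationMonoid R]
    {b : Fin 3 → R} (hb : IsPrimitiveVector b) : LinearMap.ker (crossProduct b) = R ∙ b := by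
  refine le_antisymm (fun a ha => ?_) ?_
  · have h (k : Fin 3) : (b ⨯₃ a) k = 0 := congrFun (LinearMap.mem_ker.1 ha) k
    have h₀ := h 0
    have h₁ := h 1
    have h₂ := h 2
    simp only [cross_apply, cons_val] at h₀ h₁ h₂
    obtain ⟨c, rfl⟩ := hb.exists_eq_smul (a := a) fun i j => by
      fin_cases i <;> fin_cases j <;> grind
    exact Submodule.smul_mem _ c (Submodule.mem_span_singleton_self b)
  · rw [Submodule.span_singleton_le_iff_mem, LinearMap.mem_ker, cross_self]

end PrimitiveVector

section SyzygyModule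

variable {R : Type*} [CommRing R]

/-- The module of syzygies of the vector `g`, i.e. of all `a` with `∑ i, a i * g i = 0`. -/
def syzygyModule {ι : Type*} [Fintype ι] (g : ι → R) : Submodule R (ι → R) :=
  LinearMap.ker (Fintype.linearCombination R g)

theorem mem_syzygyModule_iff {ι : Type*} [Fintype ι] {g a : ι → R} :
    a ∈ syzygyModule g ↔ a ⬝ᵥ g = 0 :=
  Iff.rfl

theorem mem_syzygyModule_of_smul_mem [IsDomain R] {ι : Type*} [Fintype ι] {g a : ι → R} {r : R}
    (hr : r ≠ 0) (h : r • a ∈ syzygyModule g) : a ∈ syzygyModule g := by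
  rw [mem_syzygyModule_iff, smul_dotProduct] at h
  exact (smul_eq_zero.1 h).resolve_left hr

theorem cross_mem_syzygyModule (g b : Fin 3 → R) : b ⨯₃ g ∈ syzygyModule g := by
  rw [mem_syzygyModule_iff, dotProduct_comm, dot_cross_self]

theorem exists_cross_eq_smul_of_mem_syzygyModule [IsDomain R] [UniqueFactorizationMonoid R]
    {g a b : Fin 3 → R} (hg : IsPrimitiveVector g) (ha : a ∈ syzygyModule g)
    (hb : b ∈ syzygyModule g) : ∃ w : R, a ⨯₃ b = w • g := by
  have h : a ⨯₃ b ∈ LinearMap.ker (crossProduct g) := by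
    rw [LinearMap.mem_ker, cross_cross_eq_smul_sub_smul', dotProduct_comm g b,
      mem_syzygyModule_iff.1 ha, mem_syzygyModule_iff.1 hb, zero_smul, zero_smul, sub_zero]
  rw [hg.ker_crossProduct, Submodule.mem_span_singleton] at h
  exact h.imp fun _ => Eq.symm

theorem mem_syzygyModule_of_cross_eq_smul [IsDomain R] {g a b : Fin 3 → R}
    (ha : a ∈ syzygyModule g) (ha₀ : a ≠ 0) {w : R} (h : a ⨯₃ b = w • g) :
    b ∈ syzygyModule g := by
  have hba : (b ⬝ᵥ g) • a = 0 := by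
    have := cross_cross_eq_smul_sub_smul a b g
    rwa [h, LinearMap.map_smul₂, cross_self, mem_syzygyModule_iff.1 ha, smul_zero, zero_smul,
      zero_sub, eq_comm, neg_eq_zero] at this
  exact (smul_eq_zero.1 hba).resolve_right ha₀

theorem eq_zero_of_forall_cross_eq_zero {g : Fin 3 → R} (h : ∀ b, b ⨯₃ g = 0) : g = 0 := by
  have h₀ := congrFun (h ![1, 0, 0])
  have h₁ := congrFun (h ![0, 1, 0]) 2
  ext i
  fin_cases i
  · simpa [cross_apply] using h₁
  · simpa [cross_apply] using h₀ 2
  · simpa [cross_apply] using h₀ 1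

theorem eq_zero_of_forall_cross_mem_span_singleton [IsDomain R] {g a : Fin 3 → R}
    (h : ∀ b, b ⨯₃ g ∈ R ∙ a) : g = 0 := by
  by_contra hg
  refine hg (eq_zero_of_forall_cross_eq_zero fun u => dotProduct_eq_zero _ fun v => ?_)
  have hcross : (u ⨯₃ g) ⨯₃ (v ⨯₃ g) = 0 := by
    obtain ⟨r, hr⟩ := Submodule.mem_span_singleton.1 (h u)
    obtain ⟨r', hr'⟩ := Submodule.mem_span_singleton.1 (h v)
    rw [← hr, ← hr', map_smul, LinearMap.map_smul₂, cross_self, smul_zero, smul_zero]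
  rw [cross_cross_eq_smul_sub_smul', dotProduct_comm _ g, dot_cross_self, zero_smul, zero_sub,
    neg_eq_zero, dotProduct_comm] at hcross
  exact (smul_eq_zero.1 hcross).resolve_right hg

end SyzygyModule

section Saturation

variable {σ R M M' : Type*} [CommRing R] [AddCommGroup M] [Module (MvPolynomial σ R) M]
  [AddCommGroup M'] [Module (MvPolynomial σ R) M']

/-- A submodule over a polynomial ring is saturated, with respect to the irrelevant ideal, if it
contains every vector all of whose multiples by the variables it contains. -/
def IsSaturated (N : Submodule (MvPolynomial σ R) M) : Prop :=
  ∀ v, (∀ i, (X i : MvPolynomial σ R) • v ∈ N) → v ∈ N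

theorem IsSaturated.comap {N : Submodule (MvPolynomial σ R) M'} (hN : IsSaturated N)
    (φ : M →ₗ[MvPolynomial σ R] M') : IsSaturated (N.comap φ) :=
  fun v hv => hN (φ v) fun i => by simpa only [Submodule.mem_comap, map_smul] using hv i

end Saturation

theorem exists_eq_add_of_X_mul_eq_add {R : Type*} [CommRing R] {c p q : MvPolynomial (Fin 3) R}
    (h : X 2 * c = X 0 * p + X 1 * q) : ∃ a b, c = X 0 * a + X 1 * b := by
  have mem_iff (g : MvPolynomial (Fin 3) R) :
      g ∈ Ideal.span (X '' ({0, 1} : Set (Fin 3))) ↔ ∃ a b, g = X 0 * a + X 1 * b := by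
    simp only [Set.image_pair, Ideal.mem_span_pair, mul_comm (X _), eq_comm]
  have hX : X 2 * c ∈ Ideal.span (X '' ({0, 1} : Set (Fin 3))) := (mem_iff _).2 ⟨p, q, h⟩
  rw [← mem_iff, mem_ideal_span_X_image]
  rw [mem_ideal_span_X_image] at hX
  intro m hm
  obtain ⟨i, hi, hne⟩ := hX (Finsupp.single 2 1 + m) (by
    rw [mem_support_iff, coeff_X_mul]
    exact mem_support_iff.1 hm)
  refine ⟨i, hi, ?_⟩
  rcases hi with rfl | rfl <;> simpa using hne

/- Among the preimages `σ i` of `X i • v`, the vectors `X j • σ i - X i • σ j` lie in the kernel,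
hence are multiples of `a`; the relation between these multiples allows to correct `σ 0` by a
multiple of `a` so that it becomes divisible by `X 0`. -/
theorem isSaturated_range_of_ker_eq_span_singleton {R ι M : Type*} [CommRing R] [IsDomain R]
    [AddCommGroup M] [Module (MvPolynomial (Fin 3) R) M]
    [Module.IsTorsionFree (MvPolynomial (Fin 3) R) M]
    {φ : (ι → MvPolynomial (Fin 3) R) →ₗ[MvPolynomial (Fin 3) R] M}
    {a : ι → MvPolynomial (Fin 3) R} (ha : a ≠ 0)
    (hker : LinearMap.ker φ = MvPolynomial (Fin 3) R ∙ a) : IsSaturated (LinearMap.range φ) := by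
  intro v hv
  choose σ hσ using hv
  have hrel (i j : Fin 3) : ∃ c : MvPolynomial (Fin 3) R,
      c • a = (X j : MvPolynomial (Fin 3) R) • σ i - (X i : MvPolynomial (Fin 3) R) • σ j := by
    rw [← Submodule.mem_span_singleton, ← hker, LinearMap.mem_ker, map_sub, map_smul, map_smul,
      hσ, hσ, smul_comm, sub_self]
  obtain ⟨c₀₁, h₀₁⟩ := hrel 0 1
  obtain ⟨c₁₂, h₁₂⟩ := hrel 1 2
  obtain ⟨c₂₀, h₂₀⟩ := hrel 2 0
  have hsum : X 2 * c₀₁ + X 0 * c₁₂ + X 1 * c₂₀ = 0 := by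
    refine (smul_eq_zero.1 (?_ : _ • a = 0)).resolve_right ha
    simp only [add_smul, mul_smul, h₀₁, h₁₂, h₂₀]
    module
  obtain ⟨B, A, rfl⟩ := exists_eq_add_of_X_mul_eq_add (c := c₀₁) (p := -c₁₂) (q := -c₂₀)
    (by linear_combination hsum)
  have hdvd (i : ι) : X 0 ∣ (σ 0 - A • a) i := by
    have hi := congrFun h₀₁ i
    simp only [Pi.sub_apply, Pi.smul_apply, smul_eq_mul] at hi ⊢
    have hX : X 0 ∣ X 1 * (σ 0 i - A * a i) := ⟨σ 1 i + B * a i, by linear_combination -hi⟩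
    exact (X_prime.dvd_mul.1 hX).resolve_left (by simp [X_dvd_X])
  choose τ hτ using hdvd
  have hXτ : σ 0 - A • a = (X 0 : MvPolynomial (Fin 3) R) • τ := funext hτ
  have hφa : φ a = 0 := LinearMap.mem_ker.1 (hker ▸ Submodule.mem_span_singleton_self a)
  refine ⟨τ, smul_right_injective M (X_ne_zero (R := R) (0 : Fin 3)) ?_⟩
  dsimp only
  rw [← map_smul, ← hXτ, map_sub, map_smul, hφa, smul_zero, sub_zero, hσ]

section CrossIdeal

variable {R : Type*} [CommRing R]

/-- The ideal of all `w` for which `w • g` is a cross product with `a`. For a primitive vector `g`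
and a primitive syzygy `a` of it, `b ↦ w` with `a ⨯₃ b = w • g` identifies it with the quotient of
the syzygies of `g` by the multiples of `a`. -/
def crossIdeal (g a : Fin 3 → R) : Ideal R :=
  (LinearMap.range (crossProduct a)).comap (LinearMap.toSpanSingleton R _ g)

theorem mem_crossIdeal_iff {g a : Fin 3 → R} {w : R} :
    w ∈ crossIdeal g a ↔ ∃ b, a ⨯₃ b = w • g :=
  Iff.rfl

theorem isSaturated_crossIdeal [IsDomain R] {g a : Fin 3 → MvPolynomial (Fin 3) R} (ha : a ≠ 0)
    (hker : LinearMap.ker (crossProduct a) = MvPolynomial (Fin 3) R ∙ a) :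
    IsSaturated (crossIdeal g a) :=
  (isSaturated_range_of_ker_eq_span_singleton ha hker).comap _

theorem map_crossProduct_syzygyModule [IsDomain R] [UniqueFactorizationMonoid R]
    {g a : Fin 3 → R} (hg : IsPrimitiveVector g) (ha : a ∈ syzygyModule g) (ha₀ : a ≠ 0) :
    (syzygyModule g).map (crossProduct a) =
      Submodule.map (LinearMap.toSpanSingleton R _ g) (crossIdeal g a) := by
  ext u
  constructor
  · rintro ⟨b, hb, rfl⟩
    obtain ⟨w, hw⟩ := exists_cross_eq_smul_of_mem_syzygyModule hg ha hb
    exact ⟨w, ⟨b, hw⟩, hw.symm⟩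
  · rintro ⟨w, ⟨b, hb⟩, rfl⟩
    exact ⟨b, mem_syzygyModule_of_cross_eq_smul ha ha₀ hb, hb⟩

theorem exists_syzygies_of_crossIdeal_le [IsDomain R] [UniqueFactorizationMonoid R]
    {g a : Fin 3 → R} (hg : IsPrimitiveVector g) (ha : a ∈ syzygyModule g)
    (ha' : IsPrimitiveVector a) {κ : Type*} {v : κ → R} (hv : ∀ i, v i ∈ crossIdeal g a)
    {𝔪 : Ideal R} (hspan : crossIdeal g a ≤ Ideal.span (Set.range v) ⊔ 𝔪 * crossIdeal g a) :
    ∃ τ : κ → Fin 3 → R, (∀ i, τ i ∈ syzygyModule g) ∧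
      syzygyModule g ≤ Submodule.span R (Set.range τ) ⊔ 𝔪 • syzygyModule g ⊔ R ∙ a := by
  choose τ hτ using fun i => mem_crossIdeal_iff.1 (hv i)
  refine ⟨τ, fun i => mem_syzygyModule_of_cross_eq_smul ha ha'.ne_zero (hτ i), ?_⟩
  rw [← ha'.ker_crossProduct, ← LinearMap.map_le_map_iff]
  calc (syzygyModule g).map (crossProduct a)
      = Submodule.map (LinearMap.toSpanSingleton R _ g) (crossIdeal g a) :=
        map_crossProduct_syzygyModule hg ha ha'.ne_zero
    _ ≤ Submodule.map (LinearMap.toSpanSingleton R _ g)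
          (Ideal.span (Set.range v) ⊔ 𝔪 • crossIdeal g a) :=
        Submodule.map_mono hspan
    _ = (Submodule.span R (Set.range τ) ⊔ 𝔪 • syzygyModule g).map (crossProduct a) := by
        have hrange : LinearMap.toSpanSingleton R _ g '' Set.range v =
            crossProduct a '' Set.range τ := by
          rw [← Set.range_comp, ← Set.range_comp]
          exact congrArg Set.range (funext fun i => (hτ i).symm)
        rw [Submodule.map_sup, Submodule.map_sup, Submodule.map_smul'', Submodule.map_smul'',
          ← map_crossProduct_syzygyModule hg ha ha'.ne_zero, Ideal.span, Submodule.map_span,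
          Submodule.map_span, hrange]

end CrossIdeal

section Homogeneous

variable {σ K A : Type*} [CommSemiring K] [CommSemiring A] [Algebra K A] {h : MvPolynomial σ K}
  {s : ℕ}

theorem degree_eq_of_mem_support (hh : h.IsHomogeneous s) {m : σ →₀ ℕ} (hm : m ∈ h.support) :
    m.degree = s := by
  rw [Finsupp.degree_eq_weight_one]
  exact hh (mem_support_iff.1 hm)

theorem aeval_mul_right_of_isHomogeneous (hh : h.IsHomogeneous s) (r : σ → A) (x : A) :
    aeval (fun j => r j * x) h = aeval r h * x ^ s := by
  rw [aeval_def, aeval_def, eval₂_eq, eval₂_eq, Finset.sum_mul]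
  refine Finset.sum_congr rfl fun m hm => ?_
  simp only [mul_pow, Finset.prod_mul_distrib, Finset.prod_pow_eq_pow_sum, mul_assoc,
    ← degree_eq_of_mem_support hh hm, Finsupp.degree_apply]

theorem prod_map_toMultiset (m : σ →₀ ℕ) (g : σ → A) :
    (m.toMultiset.map g).prod = ∏ j ∈ m.support, g j ^ m j := by
  rw [Finsupp.toMultiset_map, Finsupp.prod_toMultiset,
    Finsupp.prod_mapDomain_index (by simp) (by simp [pow_add])]
  rfl

theorem natDegree_aeval_le_of_isHomogeneous (hh : h.IsHomogeneous s) {g : σ → Polynomial A}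
    (hg : ∀ j, (g j).natDegree ≤ 1) : (aeval g h).natDegree ≤ s := by
  rw [aeval_def, eval₂_eq]
  refine Polynomial.natDegree_sum_le_of_forall_le _ _ fun m hm => ?_
  calc _ ≤ (∏ j ∈ m.support, g j ^ m j).natDegree := Polynomial.natDegree_C_mul_le _ _
    _ ≤ ∑ j ∈ m.support, (g j ^ m j).natDegree := Polynomial.natDegree_prod_le _ _
    _ ≤ ∑ j ∈ m.support, m j := Finset.sum_le_sum fun j _ =>
        (Polynomial.natDegree_pow_le_of_le _ (hg j)).trans_eq (mul_one _)
    _ = s := degree_eq_of_mem_support hh hm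

theorem coeff_aeval_of_isHomogeneous (hh : h.IsHomogeneous s) {g : σ → Polynomial A}
    (hg : ∀ j, (g j).natDegree ≤ 1) :
    (aeval g h).coeff s = aeval (fun j => (g j).coeff 1) h := by
  have hcoeff {m : σ →₀ ℕ} (hm : m ∈ h.support) :
      (∏ j ∈ m.support, g j ^ m j).coeff s = ∏ j ∈ m.support, (g j).coeff 1 ^ m j := by
    have := Polynomial.coeff_multiset_prod_of_natDegree_le (m.toMultiset.map g) 1 (by simp [hg])
    rwa [Multiset.card_map, Finsupp.card_toMultiset, mul_one, Multiset.map_map,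
      prod_map_toMultiset, prod_map_toMultiset, show m.sum (fun _ => id) = s from
      degree_eq_of_mem_support hh hm] at this
  rw [aeval_def, aeval_def, eval₂_eq, eval₂_eq, Polynomial.finsetSum_coeff]
  exact Finset.sum_congr rfl fun m hm => (Polynomial.coeff_C_mul _).trans (by rw [hcoeff hm])

end Homogeneous

theorem exists_eval_ne_zero_and_eq_one {σ K : Type*} [Field K] [Infinite K]
    {h : MvPolynomial σ K} {s : ℕ} (hh : h.IsHomogeneous s) (h₀ : h ≠ 0) (i : σ) :
    ∃ p : σ → K, p i = 1 ∧ eval p h ≠ 0 := by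
  obtain ⟨p, hp⟩ : ∃ p, eval p (h * X i) ≠ 0 := by
    by_contra! hall
    exact mul_ne_zero h₀ (X_ne_zero i) (MvPolynomial.funext (by simpa using hall))
  rw [map_mul, eval_X] at hp
  have hpi : p i ≠ 0 := right_ne_zero_of_mul hp
  refine ⟨fun j => p j * (p i)⁻¹, mul_inv_cancel₀ hpi, ?_⟩
  rw [← aeval_eq_eval, aeval_mul_right_of_isHomogeneous hh, aeval_eq_eval]
  exact mul_ne_zero (left_ne_zero_of_mul hp) (pow_ne_zero s (inv_ne_zero hpi))

theorem sub_mem_of_forall_X_sub_mem {σ K A : Type*} [CommRing K] [CommRing A] [Algebra K A]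
    {J : Ideal A} {φ ψ : MvPolynomial σ K →ₐ[K] A} (h : ∀ i, φ (X i) - ψ (X i) ∈ J)
    (f : MvPolynomial σ K) : φ f - ψ f ∈ J := by
  have : (Ideal.Quotient.mkₐ K J).comp φ = (Ideal.Quotient.mkₐ K J).comp ψ :=
    algHom_ext fun i => (Ideal.Quotient.mk_eq_mk_iff_sub_mem _ _).2 (h i)
  exact (Ideal.Quotient.mk_eq_mk_iff_sub_mem _ _).1 (DFunLike.congr_fun this f)

theorem X_mem_of_isPrime {σ K : Type*} [Field K] {P : Ideal (MvPolynomial σ K)} [P.IsPrime]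
    {h : MvPolynomial σ K} {s : ℕ} (hh : h.IsHomogeneous s) (hP : h ∈ P) {p : σ → K}
    (hp : eval p h ≠ 0) {i : σ} (hline : ∀ j, X j - C (p j) * X i ∈ P) (j : σ) : X j ∈ P := by
  have hX : X i ∈ P := by
    have hsub : h - aeval (fun j => C (p j) * X i) h ∈ P :=
      sub_mem_of_forall_X_sub_mem (φ := .id K _) (by simpa using hline) h
    have heval : aeval (fun j => C (p j) * X i) h = C (eval p h) * X i ^ s := by
      rw [aeval_mul_right_of_isHomogeneous hh]
      congr 1
      exact (aeval_algebraMap_apply _ p h).trans (by rw [aeval_eq_eval]; rfl)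
    rw [heval, Submodule.sub_mem_iff_right P hP] at hsub
    refine Ideal.IsPrime.mem_of_pow_mem ‹_› s ((Ideal.unit_mul_mem_iff_mem P ?_).1 hsub)
    exact (isUnit_iff_ne_zero.2 hp).map C
  simpa using P.add_mem (hline j) (P.mul_mem_left (C (p j)) hX)

theorem exists_isSMulRegular_sub_smul {K R M : Type*} [Field K] [Infinite K] [CommRing R]
    [IsNoetherianRing R] [Algebra K R] [AddCommGroup M] [Module R M] [Module.Finite R M] {a b : R}
    (h : ∀ P ∈ associatedPrimes R M, ¬ (a ∈ P ∧ b ∈ P)) :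
    ∃ t : K, IsSMulRegular M (a - t • b) := by
  have hunique {P : Ideal R} (hP : P ∈ associatedPrimes R M) :
      {t : K | a - t • b ∈ P}.Subsingleton := by
    intro t ht t' ht'
    by_contra hne
    have hb : b ∈ P := by
      have hsub : (t' - t) • b ∈ P := by
        convert P.sub_mem ht ht' using 1
        module
      have := Submodule.smul_of_tower_mem P (t' - t)⁻¹ hsub
      rwa [inv_smul_smul₀ (sub_ne_zero.2 (Ne.symm hne))] at this
    refine h P hP ⟨?_, hb⟩
    simpa using P.add_mem ht (Submodule.smul_of_tower_mem P t hb)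
  obtain ⟨t, ht⟩ := ((associatedPrimes.finite R M).biUnion
    fun P hP => (hunique hP).finite).infinite_compl.nonempty
  refine ⟨t, not_not.1 fun hreg => ht ?_⟩
  have : a - t • b ∈ ⋃ P ∈ associatedPrimes R M, (P : Set R) := by
    rwa [biUnion_associatedPrimes_eq_compl_regular]
  simpa using this

theorem exists_X_notMem_of_mem_associatedPrimes {σ R M : Type*} [Finite σ] [CommRing R]
    [IsNoetherianRing R] [AddCommGroup M] [Module (MvPolynomial σ R) M]
    {N : Submodule (MvPolynomial σ R) M} (hN : IsSaturated N) {P : Ideal (MvPolynomial σ R)}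
    (hP : P ∈ associatedPrimes (MvPolynomial σ R) (M ⧸ N)) : ∃ i, X i ∉ P := by
  obtain ⟨hprime, x, hx⟩ := isAssociatedPrime_iff.1 (AssociatedPrimes.mem_iff.1 hP)
  obtain ⟨w, rfl⟩ := N.mkQ_surjective x
  have mem_iff (g : MvPolynomial σ R) : g ∈ P ↔ g • w ∈ N := by
    rw [hx, Submodule.mem_colon_singleton, Submodule.mem_bot, ← map_smul, Submodule.mkQ_apply,
      Submodule.Quotient.mk_eq_zero]
  by_contra! hX
  have hw : w ∈ N := hN w fun i => (mem_iff _).1 (hX i)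
  exact hprime.ne_top ((Ideal.eq_top_iff_one P).2 ((mem_iff 1).2 (by rwa [one_smul])))

theorem exists_span_range_eq_of_le {R M : Type*} [CommRing R] [IsDomain R]
    [IsPrincipalIdealRing R] [AddCommGroup M] [Module R M] {s : ℕ} {N O : Submodule R M}
    (hNO : N ≤ O) (b : Module.Basis (Fin s) R O) :
    ∃ v : Fin s → M, Submodule.span R (Set.range v) = N := by
  obtain ⟨n, b'⟩ := Submodule.basisOfPidOfLE hNO b
  have hn : n ≤ s := by simpa using Module.Basis.card_le_card_of_le hNO b b'
  refine ⟨fun i => if h : (i : ℕ) < n then b' ⟨i, h⟩ else 0, le_antisymm ?_ ?_⟩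
  · rw [Submodule.span_le]
    rintro _ ⟨i, rfl⟩
    dsimp only
    split_ifs
    exacts [SetLike.coe_mem _, N.zero_mem]
  · conv_lhs => rw [← Submodule.map_subtype_top N, ← b'.span_eq, Submodule.map_span]
    rw [Submodule.span_le]
    rintro _ ⟨_, ⟨i, rfl⟩, rfl⟩
    exact Submodule.subset_span ⟨Fin.castLE hn i, by simp⟩

section UnivariatePolynomial

open Polynomial

variable {B : Type*} [CommRing B] [IsDomain B] [IsPrincipalIdealRing B]

/- Division by the monic polynomial `q` reduces the claim to the elements of `J` of degree less
than `s`, which form a submodule of a free module of rank `s`. -/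
theorem exists_span_range_eq_of_monic_mem {J : Ideal B[X]} {q : B[X]} (hq : q.Monic) (hJ : q ∈ J)
    {s : ℕ} (hdeg : q.natDegree ≤ s) :
    ∃ v : Fin (s + 1) → B[X], Ideal.span (Set.range v) = J := by
  obtain ⟨v, hv⟩ := exists_span_range_eq_of_le (N := J.restrictScalars B ⊓ degreeLT B s)
    inf_le_right ((Pi.basisFun B (Fin s)).map (degreeLTEquiv B s).symm)
  refine ⟨Fin.cons q v, ?_⟩
  rw [Fin.range_cons]
  refine le_antisymm (Ideal.span_le.2 (Set.insert_subset hJ ?_)) fun p hp => ?_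
  · rintro _ ⟨i, rfl⟩
    exact (hv.le (Submodule.subset_span ⟨i, rfl⟩)).1
  · have hmod : p %ₘ q ∈ J.restrictScalars B ⊓ degreeLT B s := by
      refine ⟨?_, mem_degreeLT.2 ?_⟩
      · rw [modByMonic_eq_sub_mul_div]
        exact J.sub_mem hp (J.mul_mem_right _ hJ)
      · exact (degree_modByMonic_lt p hq).trans_le (degree_le_of_natDegree_le hdeg)
    rw [← modByMonic_add_div p q]
    refine Ideal.add_mem _ ?_ (Ideal.mul_mem_right _ _ (Ideal.subset_span (Set.mem_insert _ _)))
    refine Ideal.span_mono (Set.subset_insert q _) ?_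
    exact Submodule.span_le_restrictScalars B B[X] (Set.range v) (hv.ge hmod)

theorem exists_le_span_range_sup_of_isSMulRegular {R : Type*} [CommRing R] {f : R →+* B[X]}
    (hf : Function.Surjective f) {l : R} (hker : RingHom.ker f ≤ Ideal.span {l}) {I : Ideal R}
    (hreg : IsSMulRegular (R ⧸ I) l) {h : R} (hI : h ∈ I) {s : ℕ} (hdeg : (f h).natDegree ≤ s)
    (hcoeff : IsUnit ((f h).coeff s)) :
    ∃ v : Fin (s + 1) → R,
      (∀ i, v i ∈ I) ∧ I ≤ Ideal.span (Set.range v) ⊔ Ideal.span {l} * I := by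
  obtain ⟨b, hb⟩ := hcoeff.exists_left_inv
  obtain ⟨u, hu⟩ := exists_span_range_eq_of_monic_mem (J := I.map f)
    (monic_of_natDegree_le_of_coeff_eq_one s ((natDegree_C_mul_le b (f h)).trans hdeg)
      (by rw [Polynomial.coeff_C_mul, hb]))
    (Ideal.mul_mem_left _ _ (Ideal.mem_map_of_mem f hI)) ((natDegree_C_mul_le b _).trans hdeg)
  have hlift (i) : ∃ v ∈ I, f v = u i :=
    (Ideal.mem_map_iff_of_surjective f hf).1 (hu ▸ Ideal.subset_span ⟨i, rfl⟩)
  choose v hv hfv using hlift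
  refine ⟨v, hv, fun w hw => ?_⟩
  have hmap : (Ideal.span (Set.range v)).map f = I.map f := by
    rw [Ideal.map_span, ← Set.range_comp, ← hu]
    exact congrArg (Ideal.span <| Set.range ·) (funext hfv)
  obtain ⟨w₀, hw₀, hfw⟩ := (Ideal.mem_map_iff_of_surjective f hf).1
    (hmap ▸ Ideal.mem_map_of_mem f hw)
  obtain ⟨w', hw'⟩ := Ideal.mem_span_singleton.1
    (hker (RingHom.sub_mem_ker_iff f (x := w) (y := w₀) |>.2 hfw.symm))
  have hw'I : w' ∈ I := by
    refine mem_of_isSMulRegular_quotient_of_smul_mem hreg ?_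
    rw [smul_eq_mul, ← hw']
    exact I.sub_mem hw (Ideal.span_le.2 (Set.range_subset_iff.2 hv) hw₀)
  rw [← add_sub_cancel w₀ w, hw']
  exact Submodule.add_mem_sup hw₀ (Ideal.mul_mem_mul (Ideal.mem_span_singleton_self l) hw'I)

end UnivariatePolynomial

section Line

variable {K : Type*} [Field K]

/-- Restriction of polynomials to the line through the points `p` and `q` of a projective space:
`f` is sent to `f (u q + v p)`, viewed as a polynomial in `v` with coefficients in `K[u]`. -/
noncomputable def lineRestriction {σ : Type*} (p q : σ → K) :
    MvPolynomial σ K →ₐ[K] Polynomial (Polynomial K) :=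
  aeval fun j => .C (.C (q j) * .X) + .C (.C (p j)) * .X

theorem natDegree_lineRestriction_le {σ : Type*} {h : MvPolynomial σ K} {s : ℕ}
    (hh : h.IsHomogeneous s) (p q : σ → K) : (lineRestriction p q h).natDegree ≤ s :=
  natDegree_aeval_le_of_isHomogeneous hh fun _ => by compute_degree

theorem coeff_lineRestriction {σ : Type*} {h : MvPolynomial σ K} {s : ℕ}
    (hh : h.IsHomogeneous s) (p q : σ → K) :
    (lineRestriction p q h).coeff s = .C (eval p h) := by
  rw [lineRestriction, coeff_aeval_of_isHomogeneous hh fun _ => by compute_degree]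
  simp only [Polynomial.coeff_add, Polynomial.coeff_C_succ, Polynomial.coeff_C_mul,
    Polynomial.coeff_X_one, mul_one, zero_add]
  exact (aeval_algebraMap_apply _ p h).trans (by rw [aeval_eq_eval]; rfl)

/-- The equation of the line through the points `p` and `(0 : 1 : t)` of the projective plane,
provided that `p 0 = 1`. -/
noncomputable def lineEquation (p : Fin 3 → K) (t : K) : MvPolynomial (Fin 3) K :=
  X 2 - C (p 2) * X 0 - t • (X 1 - C (p 1) * X 0)

/-- Extension of a polynomial on the line through `p` and `(0 : 1 : t)` to a polynomial on the
plane; it is a section of `lineRestriction p ![0, 1, t]` provided that `p 0 = 1`. -/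
noncomputable def lineExtension (p : Fin 3 → K) :
    Polynomial (Polynomial K) →ₐ[K] MvPolynomial (Fin 3) K :=
  Polynomial.aevalTower (Polynomial.aeval (X 1 - C (p 1) * X 0)) (X 0)

theorem lineRestriction_lineExtension {p : Fin 3 → K} (hp : p 0 = 1) (t : K)
    (g : Polynomial (Polynomial K)) :
    lineRestriction p ![0, 1, t] (lineExtension p g) = g := by
  have : ((lineRestriction p ![0, 1, t]).comp (lineExtension p)).toRingHom = .id _ := by
    ext <;> simp [lineRestriction, lineExtension, hp]
  exact DFunLike.congr_fun this g

theorem ker_lineRestriction_le {p : Fin 3 → K} (hp : p 0 = 1) (t : K) :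
    RingHom.ker (lineRestriction p ![0, 1, t]) ≤ Ideal.span {lineEquation p t} := by
  intro f hf
  have hX (i : Fin 3) : AlgHom.id K _ (X i) -
      (lineExtension p).comp (lineRestriction p ![0, 1, t]) (X i) ∈
        Ideal.span {lineEquation p t} := by
    rw [Ideal.mem_span_singleton]
    fin_cases i
    · simp [lineRestriction, lineExtension, hp]
    · simp [lineRestriction, lineExtension]
    · refine dvd_of_eq ?_
      simp only [lineEquation, smul_eq_C_mul, Fin.isValue, Fin.reduceFinMk, AlgHom.coe_id, id_eq,
        lineExtension, lineRestriction, map_mul, AlgHom.coe_comp, Function.comp_apply, aeval_X,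
        cons_val, map_add, Polynomial.aevalTower_C, Polynomial.aeval_C, algebraMap_eq,
        Polynomial.aeval_X, Polynomial.aevalTower_X]
      ring
  simpa [RingHom.mem_ker.1 hf] using sub_mem_of_forall_X_sub_mem hX f

theorem constantCoeff_lineEquation (p : Fin 3 → K) (t : K) :
    constantCoeff (lineEquation p t) = 0 := by
  simp [lineEquation, smul_eq_C_mul]

theorem exists_isSMulRegular_lineEquation [Infinite K] {I : Ideal (MvPolynomial (Fin 3) K)}
    (hI : IsSaturated I) {h : MvPolynomial (Fin 3) K} (hhI : h ∈ I) {s : ℕ}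
    (hh : h.IsHomogeneous s) {p : Fin 3 → K} (hp : p 0 = 1) (hph : eval p h ≠ 0) :
    ∃ t : K, IsSMulRegular (MvPolynomial (Fin 3) K ⧸ I) (lineEquation p t) := by
  refine exists_isSMulRegular_sub_smul fun P hP ⟨h₂, h₁⟩ => ?_
  obtain ⟨i, hi⟩ := exists_X_notMem_of_mem_associatedPrimes hI hP
  have : P.IsPrime := IsAssociatedPrime.isPrime hP
  have hIP : I ≤ P :=
    (Ideal.annihilator_quotient.ge.trans Submodule.annihilator_top.ge).trans
      (IsAssociatedPrime.annihilator_le hP)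
  refine hi (X_mem_of_isPrime hh (hIP hhI) hph (i := 0) (fun j => ?_) i)
  fin_cases j
  · simp [hp]
  · exact h₁
  · exact h₂

theorem exists_le_span_range_sup_of_isSaturated [Infinite K]
    {I : Ideal (MvPolynomial (Fin 3) K)} (hI : IsSaturated I) {h : MvPolynomial (Fin 3) K}
    (hhI : h ∈ I) {s : ℕ} (hh : h.IsHomogeneous s) (h₀ : h ≠ 0) :
    ∃ v : Fin (s + 1) → MvPolynomial (Fin 3) K, (∀ i, v i ∈ I) ∧
      I ≤ Ideal.span (Set.range v) ⊔ RingHom.ker (constantCoeff (σ := Fin 3) (R := K)) * I := by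
  obtain ⟨p, hp, hph⟩ := exists_eval_ne_zero_and_eq_one hh h₀ 0
  obtain ⟨t, ht⟩ := exists_isSMulRegular_lineEquation hI hhI hh hp hph
  have hcoeff : IsUnit ((lineRestriction p ![0, 1, t] h).coeff s) := by
    rw [coeff_lineRestriction hh]
    exact (isUnit_iff_ne_zero.2 hph).map Polynomial.C
  obtain ⟨v, hv, hle⟩ := exists_le_span_range_sup_of_isSMulRegular
    (f := (lineRestriction p ![0, 1, t]).toRingHom)
    (fun g => ⟨lineExtension p g, lineRestriction_lineExtension hp t g⟩)
    (ker_lineRestriction_le hp t) ht hhI (natDegree_lineRestriction_le hh _ _) hcoeff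
  refine ⟨v, hv, hle.trans (sup_le_sup_left (Ideal.mul_mono_left ?_) _)⟩
  rw [Ideal.span_singleton_le_iff_mem]
  exact constantCoeff_lineEquation p t

end Line

theorem card_le_card_of_span_range_le {R K M ι κ : Type*} [CommRing R] [Field K] [AddCommGroup M]
    [Module R M] [Fintype ι] [Fintype κ] {φ : R →+* K} {ρ : ι → M} {τ : κ → M}
    (hρ : ∀ c : ι → R, ∑ j, c j • ρ j = 0 → ∀ j, φ (c j) = 0)
    (hτ : ∀ i, τ i ∈ Submodule.span R (Set.range ρ))
    (hle : Submodule.span R (Set.range ρ) ≤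
      Submodule.span R (Set.range τ) ⊔ RingHom.ker φ • Submodule.span R (Set.range ρ)) :
    Fintype.card ι ≤ Fintype.card κ := by
  classical
  have hρτ (j : ι) : ∃ b : κ → R, ∃ d : ι → R, (∀ l, d l ∈ RingHom.ker φ) ∧
      ∑ i, b i • τ i + ∑ l, d l • ρ l = ρ j := by
    obtain ⟨x, hx, y, hy, hxy⟩ := Submodule.mem_sup.1 (hle (Submodule.subset_span ⟨j, rfl⟩))
    obtain ⟨b, rfl⟩ := (Submodule.mem_span_range_iff_exists_fun R).1 hx
    obtain ⟨d, hd, rfl⟩ := (Submodule.mem_ideal_smul_span_iff_exists_sum _ _ _).1 hy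
    exact ⟨b, d, hd, by rwa [Finsupp.sum_fintype _ _ fun l => zero_smul R (ρ l)] at hxy⟩
  choose b d hd hbd using hρτ
  choose a ha using fun i => (Submodule.mem_span_range_iff_exists_fun R).1 (hτ i)
  have hone : (Matrix.of b).map φ * (Matrix.of a).map φ = 1 := by
    rw [← Matrix.map_mul]
    ext j k
    have hrel : ∑ l, ((Matrix.of b * Matrix.of a) j l + d j l - (1 : Matrix ι ι R) j l) • ρ l =
        0 := by
      have hba : ∑ l, (Matrix.of b * Matrix.of a) j l • ρ l = ∑ i, b j i • τ i := by
        simp_rw [Matrix.mul_apply, Finset.sum_smul, of_apply, mul_smul, ← ha, Finset.smul_sum]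
        exact Finset.sum_comm
      simp only [add_smul, sub_smul, Finset.sum_add_distrib, Finset.sum_sub_distrib, hba, hbd,
        Matrix.one_apply, ite_smul, one_smul, zero_smul, Finset.sum_ite_eq, Finset.mem_univ,
        if_true, sub_self]
    have hk := hρ _ hrel k
    rw [map_sub, map_add, RingHom.mem_ker.1 (hd j k), add_zero, sub_eq_zero] at hk
    rw [Matrix.map_apply, hk, Matrix.one_apply, Matrix.one_apply, apply_ite φ, map_one, map_zero]
  calc Fintype.card ι = ((Matrix.of b).map φ * (Matrix.of a).map φ).rank := by
        rw [hone, Matrix.rank_one]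
    _ ≤ ((Matrix.of b).map φ).rank := Matrix.rank_mul_le_left _ _
    _ ≤ Fintype.card κ := Matrix.rank_le_card_width _

section HomogeneousComponent

variable {σ R : Type*}

theorem homogeneousComponent_mul_of_isHomogeneous [CommSemiring R] {p q : MvPolynomial σ R}
    {s : ℕ} (hq : q.IsHomogeneous s) (n : ℕ) : homogeneousComponent n (p * q) =
      if s ≤ n then homogeneousComponent (n - s) p * q else 0 := by
  conv_lhs => rw [← sum_homogeneousComponent p, Finset.sum_mul, map_sum]
  have hmem (k : ℕ) : homogeneousComponent k p * q ∈ homogeneousSubmodule σ R (k + s) :=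
    (homogeneousComponent_isHomogeneous k p).mul hq
  simp_rw [homogeneousComponent_of_mem (hmem _)]
  split_ifs with h
  · rw [Finset.sum_eq_single (n - s)]
    · rw [if_pos (by omega)]
    · intro k _ hk
      rw [if_neg (by omega)]
    · intro hk
      rw [homogeneousComponent_eq_zero _ _ (by rw [Finset.mem_range] at hk; omega), zero_mul,
        ite_self]
  · exact Finset.sum_eq_zero fun k _ => if_neg (by omega)

theorem eq_zero_of_forall_homogeneousComponent_eq_zero [CommSemiring R] {p : MvPolynomial σ R}
    (h : ∀ n, homogeneousComponent n p = 0) : p = 0 := by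
  rw [← sum_homogeneousComponent p]
  exact Finset.sum_eq_zero fun n _ => h n

theorem exists_isHomogeneous_of_mul [CommRing R] [IsDomain R] {p q : MvPolynomial σ R} {s n : ℕ}
    (hp : p ≠ 0) (hq : q ≠ 0) (hqs : q.IsHomogeneous s) (hpq : (p * q).IsHomogeneous n) :
    ∃ r, r + s = n ∧ p.IsHomogeneous r := by
  have h := homogeneousComponent_eq_self hpq
  rw [homogeneousComponent_mul_of_isHomogeneous hqs] at h
  split_ifs at h with hle
  · refine ⟨n - s, Nat.sub_add_cancel hle, ?_⟩
    rw [← mul_right_cancel₀ hq h]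
    exact homogeneousComponent_isHomogeneous _ _
  · exact absurd h.symm (mul_ne_zero hp hq)

theorem isHomogeneous_cross [CommRing R] {a b : Fin 3 → MvPolynomial σ R} {r s : ℕ}
    (ha : ∀ i, (a i).IsHomogeneous r) (hb : ∀ i, (b i).IsHomogeneous s) (i : Fin 3) :
    ((a ⨯₃ b) i).IsHomogeneous (r + s) := by
  have h (j k : Fin 3) := ((ha j).mul (hb k)).sub ((ha k).mul (hb j))
  fin_cases i
  exacts [h 1 2, h 2 0, h 0 1]

variable {ι κ : Type*} [CommSemiring R] [Fintype κ] {ρ : κ → ι → MvPolynomial σ R} {e : κ → ℕ}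

theorem homogeneousComponent_sum_smul_apply (hρ : ∀ j i, (ρ j i).IsHomogeneous (e j))
    (c : κ → MvPolynomial σ R) (n : ℕ) (i : ι) :
    homogeneousComponent n ((∑ j, c j • ρ j) i) =
      (∑ j, (if e j ≤ n then homogeneousComponent (n - e j) (c j) else 0) • ρ j) i := by
  simp only [Finset.sum_apply, Pi.smul_apply, smul_eq_mul, map_sum,
    homogeneousComponent_mul_of_isHomogeneous (hρ _ i), ite_mul, zero_mul]

theorem sum_homogeneousComponent_smul (hρ : ∀ j i, (ρ j i).IsHomogeneous (e j))
    {c : κ → MvPolynomial σ R} {n : ℕ} (hc : ∀ i, ((∑ j, c j • ρ j) i).IsHomogeneous n) :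
    ∑ j, (if e j ≤ n then homogeneousComponent (n - e j) (c j) else 0) • ρ j =
      ∑ j, c j • ρ j :=
  funext fun i => by
    rw [← homogeneousComponent_sum_smul_apply hρ, homogeneousComponent_eq_self (hc i)]

end HomogeneousComponent

section Generators

/-- The family `ρ` consists of homogeneous vectors, `ρ j` of degree `e j` (all its coordinates are
homogeneous polynomials of that degree), and it generates the submodule `N`. -/
structure IsHomogeneousGenerating {σ R ι κ : Type*} [CommSemiring R]
    (N : Submodule (MvPolynomial σ R) (ι → MvPolynomial σ R)) (ρ : κ → ι → MvPolynomial σ R)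
    (e : κ → ℕ) : Prop where
  homogeneous : ∀ j i, (ρ j i).IsHomogeneous (e j)
  span_eq : Submodule.span (MvPolynomial σ R) (Set.range ρ) = N

/-- The family `ρ` is a system of homogeneous generators of the submodule `N`, of degrees given by
`e`, with the least possible number of members. -/
structure IsMinimalHomogeneousGenerating {σ R ι : Type*} [CommSemiring R]
    (N : Submodule (MvPolynomial σ R) (ι → MvPolynomial σ R)) {m : ℕ}
    (ρ : Fin m → ι → MvPolynomial σ R) (e : Fin m → ℕ) : Prop
    extends IsHomogeneousGenerating N ρ e where
  minimal : ∀ (n : ℕ) (ρ' : Fin n → ι → MvPolynomial σ R) (e' : Fin n → ℕ),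
    IsHomogeneousGenerating N ρ' e' → m ≤ n

namespace IsHomogeneousGenerating

variable {σ R ι κ : Type*} [CommSemiring R]
  {N : Submodule (MvPolynomial σ R) (ι → MvPolynomial σ R)} {ρ : κ → ι → MvPolynomial σ R}
  {e : κ → ℕ} {τ : ι → MvPolynomial σ R}

theorem mem (h : IsHomogeneousGenerating N ρ e) (j : κ) : ρ j ∈ N :=
  h.span_eq ▸ Submodule.subset_span ⟨j, rfl⟩

theorem exists_sum_smul_eq [Fintype κ] (h : IsHomogeneousGenerating N ρ e) (hτ : τ ∈ N) :
    ∃ c : κ → MvPolynomial σ R, ∑ j, c j • ρ j = τ :=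
  (Submodule.mem_span_range_iff_exists_fun _).1 (h.span_eq ▸ hτ)

theorem mem_span_of_isHomogeneous [Finite κ] (h : IsHomogeneousGenerating N ρ e) (hτ : τ ∈ N)
    {n : ℕ} (hτn : ∀ i, (τ i).IsHomogeneous n) :
    τ ∈ Submodule.span (MvPolynomial σ R) (ρ '' {j | e j ≤ n}) := by
  have := Fintype.ofFinite κ
  obtain ⟨c, rfl⟩ := h.exists_sum_smul_eq hτ
  rw [← sum_homogeneousComponent_smul h.homogeneous hτn]
  refine Submodule.sum_mem _ fun j _ => ?_
  split_ifs with hj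
  · exact Submodule.smul_mem _ _ (Submodule.subset_span ⟨j, hj, rfl⟩)
  · rw [zero_smul]
    exact Submodule.zero_mem _

theorem eq_zero_of_totalDegree_lt [Finite κ] (h : IsHomogeneousGenerating N ρ e) (hτ : τ ∈ N)
    (hdeg : ∀ i, τ i ≠ 0 → ∀ j, (τ i).totalDegree < e j) : τ = 0 := by
  have := Fintype.ofFinite κ
  obtain ⟨c, rfl⟩ := h.exists_sum_smul_eq hτ
  ext1 i
  by_contra hi
  refine hi (eq_zero_of_forall_homogeneousComponent_eq_zero fun n => ?_)
  rcases lt_or_ge ((∑ j, c j • ρ j) i).totalDegree n with hn | hn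
  · exact homogeneousComponent_eq_zero _ _ hn
  · rw [homogeneousComponent_sum_smul_apply h.homogeneous, Finset.sum_apply]
    refine Finset.sum_eq_zero fun j _ => ?_
    rw [if_neg (hn.trans_lt (hdeg i hi j)).not_ge, zero_smul, Pi.zero_apply]

end IsHomogeneousGenerating

theorem IsHomogeneousGenerating.isPrimitiveVector {σ K ι κ : Type*} [Field K] [Finite κ]
    {N : Submodule (MvPolynomial σ K) (ι → MvPolynomial σ K)} {ρ : κ → ι → MvPolynomial σ K}
    {e : κ → ℕ} (h : IsHomogeneousGenerating N ρ e)
    (hN : ∀ (p : MvPolynomial σ K) (a : ι → MvPolynomial σ K), p ≠ 0 → p • a ∈ N → a ∈ N)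
    {k : κ} (hk : ∀ j, e k ≤ e j) (hρk : ρ k ≠ 0) : IsPrimitiveVector (ρ k) := by
  intro p hp
  choose τ hτ using hp
  have hτρ : ρ k = p • τ := funext hτ
  have hp₀ : p ≠ 0 := by
    rintro rfl
    exact hρk (by rw [hτρ, zero_smul])
  by_contra hunit
  have hpdeg : 0 < p.totalDegree := Nat.pos_of_ne_zero fun hdeg =>
    hunit (isUnit_iff_totalDegree_of_isReduced.2
      ⟨isUnit_iff_ne_zero.2 fun hcoeff => hp₀ (by
        rw [totalDegree_eq_zero_iff_eq_C.1 hdeg, hcoeff, C_0]), hdeg⟩)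
  refine hρk ?_
  rw [hτρ, h.eq_zero_of_totalDegree_lt (hN p τ hp₀ (hτρ ▸ h.mem k)) fun i hi j => ?_, smul_zero]
  calc (τ i).totalDegree < p.totalDegree + (τ i).totalDegree := Nat.lt_add_of_pos_left hpdeg
    _ = (ρ k i).totalDegree := by rw [hτ, totalDegree_mul_of_isDomain hp₀ hi]
    _ = e k := (h.homogeneous k i).totalDegree (by rw [hτ]; exact mul_ne_zero hp₀ hi)
    _ ≤ e j := hk j

namespace IsHomogeneousGenerating

variable {σ R : Type*} [CommRing R] [IsDomain R] {δ : ℕ} {g : Fin 3 → MvPolynomial σ R}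

theorem exists_le_and_notMem_span_singleton {κ : Type*} [Finite κ]
    {ρ : κ → Fin 3 → MvPolynomial σ R} {e : κ → ℕ}
    (h : IsHomogeneousGenerating (syzygyModule g) ρ e) (hg : ∀ i, (g i).IsHomogeneous δ)
    (hg₀ : g ≠ 0) (a : Fin 3 → MvPolynomial σ R) :
    ∃ j, e j ≤ δ ∧ ρ j ∉ MvPolynomial σ R ∙ a := by
  by_contra! hall
  have hspan : Submodule.span (MvPolynomial σ R) (ρ '' {j | e j ≤ δ}) ≤ MvPolynomial σ R ∙ a :=
    Submodule.span_le.2 (Set.image_subset_iff.2 hall)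
  have hbasis (i : Fin 3) : Pi.single i 1 ⨯₃ g ∈ MvPolynomial σ R ∙ a := by
    have hone (l : Fin 3) :
        ((Pi.single i 1 : Fin 3 → MvPolynomial σ R) l).IsHomogeneous 0 := by
      rw [Pi.single_apply]
      split_ifs
      exacts [isHomogeneous_one σ R, isHomogeneous_zero σ R 0]
    refine hspan (h.mem_span_of_isHomogeneous (cross_mem_syzygyModule g _) fun l => ?_)
    simpa only [zero_add] using isHomogeneous_cross hone hg l
  refine hg₀ (eq_zero_of_forall_cross_mem_span_singleton (a := a) fun b => ?_)
  suffices ⊤ ≤ (MvPolynomial σ R ∙ a).comap (crossProduct.flip g) from this trivial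
  rw [← (Pi.basisFun (MvPolynomial σ R) (Fin 3)).span_eq, Submodule.span_le]
  rintro _ ⟨i, rfl⟩
  rw [Pi.basisFun_apply]
  exact hbasis i

theorem exists_two_le_and_exponent_le {m : ℕ} {ρ : Fin m → Fin 3 → MvPolynomial σ R}
    {e : Fin m → ℕ} (h : IsHomogeneousGenerating (syzygyModule g) ρ e)
    (hg : ∀ i, (g i).IsHomogeneous δ) (hg₀ : g ≠ 0) (he : Monotone e) :
    ∃ hm : 2 ≤ m, e ⟨1, hm⟩ ≤ δ := by
  obtain ⟨j₀, -, -⟩ := h.exists_le_and_notMem_span_singleton hg hg₀ 0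
  obtain ⟨j, hjδ, hj⟩ := h.exists_le_and_notMem_span_singleton hg hg₀ (ρ ⟨0, j₀.pos⟩)
  have hj₁ : 1 ≤ (j : ℕ) := Nat.one_le_iff_ne_zero.2 fun hj₀ => hj (by
    rw [show j = ⟨0, j₀.pos⟩ from Fin.ext hj₀]
    exact Submodule.mem_span_singleton_self _)
  exact ⟨Nat.succ_le_of_lt (hj₁.trans_lt j.isLt), (he (Fin.mk_le_of_le_val hj₁)).trans hjδ⟩

end IsHomogeneousGenerating

namespace IsMinimalHomogeneousGenerating

section Semiring

variable {σ R ι : Type*} [CommSemiring R]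
  {N : Submodule (MvPolynomial σ R) (ι → MvPolynomial σ R)} {m : ℕ}
  {ρ : Fin m → ι → MvPolynomial σ R} {e : Fin m → ℕ}

theorem notMem_span_image_compl (h : IsMinimalHomogeneousGenerating N ρ e) (k : Fin m) :
    ρ k ∉ Submodule.span (MvPolynomial σ R) (ρ '' {k}ᶜ) := by
  intro hk
  obtain ⟨m, rfl⟩ : ∃ m', m = m' + 1 := ⟨m - 1, by have := k.pos; omega⟩
  refine (h.minimal m (ρ ∘ k.succAbove) (e ∘ k.succAbove) ⟨fun j => h.homogeneous _, ?_⟩).not_gt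
    (Nat.lt_succ_self m)
  rw [Set.range_comp, Fin.range_succAbove, ← Submodule.span_insert_eq_span hk,
    ← Set.image_insert_eq, Set.insert_eq, Set.union_compl_self, Set.image_univ, h.span_eq]

theorem ne_zero (h : IsMinimalHomogeneousGenerating N ρ e) (k : Fin m) : ρ k ≠ 0 := fun hk =>
  h.notMem_span_image_compl k (hk ▸ Submodule.zero_mem _)

theorem notMem_span_singleton (h : IsMinimalHomogeneousGenerating N ρ e) {k l : Fin m}
    (hkl : k ≠ l) : ρ l ∉ MvPolynomial σ R ∙ ρ k := fun hl =>
  h.notMem_span_image_compl l (Submodule.span_mono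
    (Set.singleton_subset_iff.2 (Set.mem_image_of_mem ρ hkl)) hl)

end Semiring

variable {σ K ι : Type*} [Field K] {N : Submodule (MvPolynomial σ K) (ι → MvPolynomial σ K)}
  {m : ℕ} {ρ : Fin m → ι → MvPolynomial σ K} {e : Fin m → ℕ}

theorem constantCoeff_eq_zero (h : IsMinimalHomogeneousGenerating N ρ e)
    {c : Fin m → MvPolynomial σ K} (hc : ∑ j, c j • ρ j = 0) (k : Fin m) :
    constantCoeff (c k) = 0 := by
  by_contra hk
  refine h.notMem_span_image_compl k ?_
  have hsum := sum_homogeneousComponent_smul (n := e k) h.homogeneous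
    fun i => by rw [hc]; exact isHomogeneous_zero σ K _
  rw [hc, ← Finset.add_sum_erase _ _ (Finset.mem_univ k), if_pos le_rfl, tsub_self,
    homogeneousComponent_zero, add_eq_zero_iff_eq_neg] at hsum
  have hunit : IsUnit (C (coeff 0 (c k)) : MvPolynomial σ K) :=
    (isUnit_iff_ne_zero.2 hk).map C
  rw [← Submodule.smul_mem_iff_of_isUnit _ hunit, hsum]
  refine Submodule.neg_mem _ (Submodule.sum_mem _ fun j hj => Submodule.smul_mem _ _ ?_)
  exact Submodule.subset_span ⟨j, Finset.ne_of_mem_erase hj, rfl⟩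

theorem card_le_of_span_le (h : IsMinimalHomogeneousGenerating N ρ e) {κ : Type*} [Fintype κ]
    {τ : κ → ι → MvPolynomial σ K} (hτ : ∀ i, τ i ∈ N)
    (hle : N ≤ Submodule.span (MvPolynomial σ K) (Set.range τ) ⊔
      RingHom.ker (constantCoeff (σ := σ) (R := K)) • N) : m ≤ Fintype.card κ := by
  rw [← Fintype.card_fin m]
  refine card_le_card_of_span_range_le (φ := constantCoeff (σ := σ) (R := K)) (ρ := ρ) (τ := τ)
    (fun c => h.constantCoeff_eq_zero) ?_ ?_
  · rwa [h.span_eq]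
  · rwa [h.span_eq]

theorem card_add_le [Infinite K] {δ : ℕ} {g : Fin 3 → MvPolynomial (Fin 3) K}
    {ρ : Fin m → Fin 3 → MvPolynomial (Fin 3) K}
    (h : IsMinimalHomogeneousGenerating (syzygyModule g) ρ e) (hg : ∀ i, (g i).IsHomogeneous δ)
    (hprim : IsPrimitiveVector g) {k l : Fin m} (hkl : k ≠ l) (hk : ∀ j, e k ≤ e j) :
    m + δ ≤ e k + e l + 2 := by
  have hρk : IsPrimitiveVector (ρ k) :=
    h.isPrimitiveVector (fun _ _ => mem_syzygyModule_of_smul_mem) hk (h.ne_zero k)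
  obtain ⟨w, hw⟩ := exists_cross_eq_smul_of_mem_syzygyModule hprim (h.mem k) (h.mem l)
  have hw₀ : w ≠ 0 := by
    rintro rfl
    refine h.notMem_span_singleton hkl ?_
    rw [← hρk.ker_crossProduct, LinearMap.mem_ker, hw, zero_smul]
  obtain ⟨i, hi⟩ := Function.ne_iff.1 hprim.ne_zero
  obtain ⟨s, hs, hws⟩ : ∃ s, s + δ = e k + e l ∧ w.IsHomogeneous s := by
    refine exists_isHomogeneous_of_mul hw₀ hi (hg i) ?_
    simpa only [hw, Pi.smul_apply, smul_eq_mul] using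
      isHomogeneous_cross (h.homogeneous k) (h.homogeneous l) i
  obtain ⟨v, hv, hvspan⟩ := exists_le_span_range_sup_of_isSaturated
    (isSaturated_crossIdeal (g := g) hρk.ne_zero hρk.ker_crossProduct)
    (mem_crossIdeal_iff.2 ⟨ρ l, hw⟩) hws hw₀
  obtain ⟨τ, hτ, hτspan⟩ := exists_syzygies_of_crossIdeal_le hprim (h.mem k) hρk hv hvspan
  have hm : m ≤ Fintype.card (Fin (s + 1 + 1)) := by
    refine h.card_le_of_span_le (τ := Fin.cons (ρ k) τ) (Fin.cases (h.mem k) hτ) ?_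
    rwa [Fin.range_cons, Submodule.span_insert, sup_assoc, sup_comm]
  rw [Fintype.card_fin] at hm
  omega

end IsMinimalHomogeneousGenerating

end Generators

section Gradient

theorem totalDegree_pderiv_lt {σ R : Type*} [CommSemiring R] {p : MvPolynomial σ R} {i : σ}
    (h : pderiv i p ≠ 0) : (pderiv i p).totalDegree < p.totalDegree := by
  have hlt {m : σ →₀ ℕ} (hm : coeff m (pderiv i p) ≠ 0) : m.degree < p.totalDegree := by
    rw [coeff_pderiv] at hm
    have := le_totalDegree (mem_support_iff.2 (left_ne_zero_of_mul hm))
    change (m + Finsupp.single i 1).degree ≤ _ at this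
    rw [map_add, Finsupp.degree_single] at this
    omega
  obtain ⟨m, hm⟩ := ne_zero_iff.1 h
  exact (Finset.sup_lt_iff (Nat.zero_lt_of_lt (hlt hm))).2 fun m hm => hlt (mem_support_iff.1 hm)

theorem pderiv_eq_zero_of_dvd {σ R : Type*} [CommRing R] [IsDomain R] {p : MvPolynomial σ R}
    {i : σ} (h : p ∣ pderiv i p) : pderiv i p = 0 := by
  by_contra hne
  exact (totalDegree_pderiv_lt hne).not_ge (totalDegree_le_of_dvd_of_isDomain h hne)

theorem eq_C_of_forall_pderiv_eq_zero {σ R : Type*} [CommSemiring R] [NoZeroDivisors R]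
    [CharZero R] {p : MvPolynomial σ R} (h : ∀ i, pderiv i p = 0) : p = C (coeff 0 p) := by
  classical
  ext m
  rw [coeff_C]
  split_ifs with hm
  · rw [hm]
  · obtain ⟨i, hi⟩ := Finsupp.ne_iff.1 (Ne.symm hm)
    have hle : Finsupp.single i 1 ≤ m := Finsupp.single_le_iff.2 (Nat.one_le_iff_ne_zero.2 hi)
    have hcoeff := coeff_pderiv (i := i) p (m - Finsupp.single i 1)
    rw [h i, coeff_zero, tsub_add_cancel_of_le hle] at hcoeff
    exact (mul_eq_zero.1 hcoeff.symm).resolve_right (Nat.cast_add_one_ne_zero _)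

variable {σ K : Type*} [Field K] [CharZero K]

theorem exists_pderiv_ne_zero_of_irreducible {p : MvPolynomial σ K} (hp : Irreducible p) :
    ∃ i, pderiv i p ≠ 0 := by
  by_contra! h
  have hC := eq_C_of_forall_pderiv_eq_zero h
  refine hp.not_isUnit (hC ▸ (isUnit_iff_ne_zero.2 fun hcoeff => hp.ne_zero ?_).map C)
  rw [hC, hcoeff, C_0]

variable [Finite σ] {f : MvPolynomial σ K} {d : ℕ}

theorem dvd_of_forall_dvd_pderiv (hd : d ≠ 0) (hf : f.IsHomogeneous d) {p : MvPolynomial σ K}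
    (hp : ∀ i, p ∣ pderiv i f) : p ∣ f := by
  have := Fintype.ofFinite σ
  have hdvd : p ∣ C (d : K) * f := by
    rw [map_natCast, ← nsmul_eq_mul, ← hf.sum_X_mul_pderiv]
    exact Finset.dvd_sum fun i _ => (hp i).mul_left _
  exact ((isUnit_iff_ne_zero.2 (Nat.cast_ne_zero.2 hd)).map C).dvd_mul_left.1 hdvd

theorem isPrimitiveVector_pderiv_of_squarefree (hd : d ≠ 0) (hf : f.IsHomogeneous d)
    (hred : Squarefree f) : IsPrimitiveVector fun i => pderiv i f := by
  intro g hg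
  by_contra hunit
  have hgf : g ∣ f := dvd_of_forall_dvd_pderiv hd hf hg
  obtain ⟨p, hp, hpg⟩ :=
    WfDvdMonoid.exists_irreducible_factor hunit (ne_zero_of_dvd_ne_zero hred.ne_zero hgf)
  obtain ⟨q, rfl⟩ := hpg.trans hgf
  have hpq : ¬ p ∣ q := fun hpq => hp.not_isUnit (hred p (mul_dvd_mul_left p hpq))
  obtain ⟨i, hi⟩ := exists_pderiv_ne_zero_of_irreducible hp
  refine hi (pderiv_eq_zero_of_dvd ?_)
  have hdvd : p ∣ pderiv i p * q + p * pderiv i q := by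
    rw [← pderiv_mul]
    exact hpg.trans (hg i)
  exact (hp.prime.dvd_mul.1 ((dvd_add_left (dvd_mul_right _ _)).1 hdvd)).resolve_right hpq

end Gradient

namespace PlaneCurve

variable {f : S} {m : ℕ} {e : Fin m → ℕ}

theorem homogeneousGenerators_iff {ρ : Fin m → Fin 3 → S} : HomogeneousGenerators f ρ e ↔
    IsHomogeneousGenerating (syzygyModule fun i => pderiv i f) ρ e :=
  ⟨fun h => ⟨h.homogeneous, h.span_eq⟩, fun h => ⟨h.homogeneous, h.span_eq⟩⟩

theorem IsSyzygyCurve.exists_isMinimalHomogeneousGenerating (hC : IsSyzygyCurve f m e) :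
    ∃ ρ, IsMinimalHomogeneousGenerating (syzygyModule fun i => pderiv i f) ρ e := by
  obtain ⟨ρ, hρ⟩ := hC.generated
  exact ⟨ρ, homogeneousGenerators_iff.1 hρ, fun n ρ' e' h =>
    hC.minimal n ρ' e' (homogeneousGenerators_iff.2 h)⟩

end PlaneCurve

theorem proposition2p1_general {K : Type*} [Field K] [Infinite K] {δ : ℕ}
    {g : Fin 3 → MvPolynomial (Fin 3) K} (hg : ∀ i, (g i).IsHomogeneous δ)
    (hprim : IsPrimitiveVector g) {m : ℕ} {ρ : Fin m → Fin 3 → MvPolynomial (Fin 3) K}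
    {e : Fin m → ℕ} (he : Monotone e) (hρ : IsMinimalHomogeneousGenerating (syzygyModule g) ρ e) :
    ∃ hm : 2 ≤ m, m + δ ≤ e ⟨0, by omega⟩ + e ⟨1, by omega⟩ + 2 ∧ e ⟨1, by omega⟩ ≤ δ := by
  obtain ⟨hm, he₁⟩ := hρ.exists_two_le_and_exponent_le hg hprim.ne_zero he
  refine ⟨hm, hρ.card_add_le hg hprim (by simp) fun j => ?_, he₁⟩
  exact he (Fin.mk_le_of_le_val (Nat.zero_le _))

theorem proposition2p1 (d : ℕ) (hd : 3 ≤ d) (f : PlaneCurve.S) (hf : f.IsHomogeneous d)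
    (hred : Squarefree f) (m : ℕ) (e : Fin m → ℕ) (hC : PlaneCurve.IsSyzygyCurve f m e)
    (he : ∀ j, 1 ≤ e j) :
    ∃ hm : 2 ≤ m,
      (m : ℤ) ≤ (e ⟨0, by omega⟩ : ℤ) + (e ⟨1, by omega⟩ : ℤ) - (d : ℤ) + 3 ∧
      (e ⟨0, by omega⟩ : ℤ) + (e ⟨1, by omega⟩ : ℤ) - (d : ℤ) + 3 ≤ (e ⟨0, by omega⟩ : ℤ) + 2 ∧
      (e ⟨0, by omega⟩ : ℤ) + 2 ≤ (d : ℤ) + 1 := by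
  obtain ⟨ρ, hρ⟩ := hC.exists_isMinimalHomogeneousGenerating
  obtain ⟨hm, hcard, hexp⟩ := proposition2p1_general (δ := d - 1) (fun _ => hf.pderiv)
    (isPrimitiveVector_pderiv_of_squarefree (by omega) hf hred) hC.monotone hρ
  have hexp₀ : e ⟨0, by omega⟩ ≤ e ⟨1, by omega⟩ := hC.monotone (by simp)
  exact ⟨hm, by omega, by omega, by omega⟩
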